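/- Let $m\ge 1$ and consider $N$ agents with the $m$-dimensional integrator-chain dynamics $$\dot x_i(t)=Ax_i(t)+Bu_i(t),\qquad y_i(t)=Cx_i(t),\qquad i=1,\dots,N,$$ where $x_i(t)\in\mathbb R^m$, $A\in\mathbb R^{m\times m}$ has ones on the superdiagonal and zeros elsewhere, $B=(0,\dots,0,1)^T$, $C\in\mathbb R^{1\times m}$, and only the output $y_i$ is measured. Let $\mathcal G_p$, $p\in\mathcal S$, be finitely many digraphs without self-loops on the nodes $v_1,\dots,v_N$. An edge from $v_j$ to $v_i$ means that agent $i$ receives information from agent $j$; in $\mathcal G_p$ it carries a constant weight $\alpha^{ij}_p>0$, and $\mathcal N_i(p)$ is the set of the $j$ for which this edge is in $\mathcal G_p$. Let $\sigma:[0,\infty)\to\mathcal S$ be piecewise constant and right-continuous, with the lengths of the intervals between consecutive switching times bounded below by some $\tau_D>0$. Given real gains $a_1,\dots,a_{m-1}$, put $K_1=(0,-a_1,\dots,-a_{m-1})$ and $K_2=(a_1,\dots,a_{m-1},1)$, let $K_3\in\mathbb R^{m\times 1}$, and consider the dynamic output-feedback protocol $$u_i(t)=K_1s_i(t)-\sum_{j\in\mathcal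 N_i(\sigma(t))}\alpha^{ij}_{\sigma(t)}K_2\bigl(s_i(t)-s_j(t)\bigr),$$ $$\dot s_i(t)=(A+K_3C)s_i(t)+Bu_i(t)-K_3y_i(t),$$ with observer states $s_i(t)\in\mathbb R^m$. Assume that 1. every eigenvalue of $A+K_3C$ has negative real part; 2. every complex root of $s^{m-1}+a_{m-1}s^{m-2}+\dots+a_2s+a_1$ has negative real part; 3. $\mathcal G_{\sigma(t)}$ is uniformly jointly quasi-strongly connected: there is $T>0$ such that for every $t>0$ the union of the graphs $\mathcal G_{\sigma(\tau)}$, $\tau\in[t,t+T)$, has a node from which there are directed paths to all other nodes. Then the protocol solves the consensus problem: for all initial states $x_i(0)$, $s_i(0)$, the trajectories of the closed-loop system satisfy $\lim_{t\to\infty}x_i(t)=x^*$ for all $i=1,\dots,N$, with a common vector $x^*\in\mathbb R^m$ (which may depend on the trajectory). -/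

import Mathlib

open Set Filter Topology Matrix Polynomial

noncomputable section

namespace HighOrderConsensus

/-! ### Communication graphs

In a digraph on the agents, `G.Adj j i` is the edge from agent `j` to agent `i`:
agent `i` receives information from agent `j`. -/

/-- A center (root): from it there is a directed path to every other node. -/
def IsCenter {N : ℕ} (G : Digraph (Fin N)) (c : Fin N) : Prop :=
  ∀ v : Fin N, v ≠ c → Relation.ReflTransGen G.Adj c v

/-- A digraph is quasi-strongly connected if it has at least one center. -/
def QuasiStronglyConnected {N : ℕ} (G : Digraph (Fin N)) : Prop :=
  ∃ c : Fin N, IsCenter G c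

open Classical in
/-- The neighbors of agent `i`: the agents from which `i` receives information. -/
def neighbors {N : ℕ} (G : Digraph (Fin N)) (i : Fin N) : Finset (Fin N) :=
  Finset.univ.filter fun j => G.Adj j i

/-- The union of the graphs `G (σ τ)` over the times `τ ∈ [t₁, t₂)`. -/
def unionGraph {N : ℕ} {S : Type*} (G : S → Digraph (Fin N)) (σ : ℝ → S) (t₁ t₂ : ℝ) :
    Digraph (Fin N) where
  Adj j i := ∃ τ ∈ Ico t₁ t₂, (G (σ τ)).Adj j i

/-- Uniform joint quasi-strong connectivity of the switching topology `G (σ t)`. -/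
def UniformlyJointlyQSC {N : ℕ} {S : Type*} (G : S → Digraph (Fin N)) (σ : ℝ → S) : Prop :=
  ∃ T : ℝ, 0 < T ∧ ∀ t : ℝ, 0 < t → QuasiStronglyConnected (unionGraph G σ t (t + T))

/-- `σ` is, on `[0, ∞)`, a piecewise constant (right-continuous) switching signal whose dwell times
are bounded below by some `τD > 0`: it is constant on each `[t k, t (k + 1))`.
The signal is not required to change its value at `t k`, so that signals with finitely many
switches, or none, are included. Values of `σ` at negative times play no role. -/
def IsSwitchingSignal {S : Type*} (σ : ℝ → S) : Prop :=
  ∃ τD : ℝ, 0 < τD ∧ ∃ t : ℕ → ℝ, t 0 = 0 ∧ (∀ k, τD ≤ t (k + 1) - t k) ∧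
    ∀ k, ∀ τ ∈ Ico (t k) (t (k + 1)), σ τ = σ (t k)

/-! ### Agents of order `m = n + 1` -/

/-- The `(n+1) × (n+1)` matrix of the chain of integrators: ones on the superdiagonal. -/
def sysA (n : ℕ) : Matrix (Fin (n + 1)) (Fin (n + 1)) ℝ :=
  Matrix.of fun i j => if (j : ℕ) = (i : ℕ) + 1 then 1 else 0

/-- The input vector `(0, …, 0, 1)ᵀ`. -/
def sysB (n : ℕ) : Fin (n + 1) → ℝ := Pi.single (Fin.last n) 1

/-- The gain `K₁ = (0, -a₁, …, -aₙ)`; the coefficient `a_{k+1}` is `a k`, `k = 0, …, n - 1`. -/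
def gainK₁ {n : ℕ} (a : Fin n → ℝ) : Fin (n + 1) → ℝ :=
  Fin.cons (α := fun _ => ℝ) 0 fun k => -a k

/-- The gain `K₂ = (a₁, …, aₙ, 1)`. -/
def gainK₂ {n : ℕ} (a : Fin n → ℝ) : Fin (n + 1) → ℝ :=
  Fin.snoc (α := fun _ => ℝ) a 1

/-- The polynomial `sⁿ + aₙ sⁿ⁻¹ + ⋯ + a₂ s + a₁`, with `n = m - 1`. -/
def gainPoly {n : ℕ} (a : Fin n → ℝ) : ℝ[X] :=
  X ^ n + ∑ k : Fin n, Polynomial.C (a k) * X ^ (k : ℕ)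

/-- All complex roots lie in the open left half-plane. -/
def HurwitzPoly (p : ℝ[X]) : Prop := ∀ z : ℂ, aeval z p = 0 → z.re < 0

/-- All complex eigenvalues of the real matrix lie in the open left half-plane. -/
def HurwitzMatrix {m : ℕ} (M : Matrix (Fin m) (Fin m) ℝ) : Prop :=
  ∀ z ∈ spectrum ℂ (M.map ((↑) : ℝ → ℂ)), z.re < 0

/-- The matrix `A + K₃ C` of the observer (`K₃` a column vector, `C` a row vector). -/
def observerMatrix {n : ℕ} (C K₃ : Fin (n + 1) → ℝ) : Matrix (Fin (n + 1)) (Fin (n + 1)) ℝ :=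
  sysA n + vecMulVec K₃ C

/-- The control input of agent `i` at the observer states `s`, over the graph `G` with weights `α`:
`uᵢ = K₁ sᵢ - ∑_{j ∈ 𝒩ᵢ} α i j * K₂ (sᵢ - sⱼ)`. -/
def control {n N : ℕ} (a : Fin n → ℝ) (G : Digraph (Fin N)) (α : Fin N → Fin N → ℝ)
    (s : Fin N → Fin (n + 1) → ℝ) (i : Fin N) : ℝ :=
  gainK₁ a ⬝ᵥ s i - ∑ j ∈ neighbors G i, α i j * (gainK₂ a ⬝ᵥ (s i - s j))

/-- The agents' states `x i` and the observers' states `s i` form a trajectory on `[0, ∞)` of the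
multi-agent system under the observer-based output feedback protocol:
`xᵢ' = A xᵢ + B uᵢ`, `yᵢ = C xᵢ`, `sᵢ' = (A + K₃ C) sᵢ + B uᵢ - K₃ yᵢ`.
As the right-hand sides jump when the topology switches, trajectories are continuous and the
equations hold with right derivatives; between two switches, where the right-hand sides are
continuous, these are ordinary derivatives. -/
structure IsTrajectory {n N : ℕ} {S : Type*} (a : Fin n → ℝ) (C K₃ : Fin (n + 1) → ℝ)
    (G : S → Digraph (Fin N)) (α : S → Fin N → Fin N → ℝ) (σ : ℝ → S)
    (x s : Fin N → ℝ → Fin (n + 1) → ℝ) : Prop where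
  continuousOn_state : ∀ i, ContinuousOn (x i) (Ici 0)
  continuousOn_observer : ∀ i, ContinuousOn (s i) (Ici 0)
  state_eq : ∀ i, ∀ t : ℝ, 0 ≤ t →
    HasDerivWithinAt (x i)
      (sysA n *ᵥ x i t + control a (G (σ t)) (α (σ t)) (fun j => s j t) i • sysB n) (Ici t) t
  observer_eq : ∀ i, ∀ t : ℝ, 0 ≤ t →
    HasDerivWithinAt (s i)
      (observerMatrix C K₃ *ᵥ s i t
        + control a (G (σ t)) (α (σ t)) (fun j => s j t) i • sysB n
        - (C ⬝ᵥ x i t) • K₃) (Ici t) t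

/-- Consensus: all the agents' states converge to one common vector. -/
def ReachesConsensus {n N : ℕ} (x : Fin N → ℝ → Fin (n + 1) → ℝ) : Prop :=
  ∃ xstar : Fin (n + 1) → ℝ, ∀ i, Tendsto (x i) atTop (𝓝 xstar)

end HighOrderConsensus

end

/-! The observer error `s i - x i` obeys the autonomous system with matrix `A + K₃ C`, whatever the
topology, so it decays exponentially. The gains satisfy `K₂ A = -K₁` and `K₂ B = 1`, so the scalars
`ξᵢ = K₂ sᵢ` follow `ξᵢ' = ∑ⱼ wᵢⱼ (ξⱼ - ξᵢ) + δᵢ`: first-order consensus, with an exponentially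
small `δᵢ` coming from the error.

The `ξᵢ` converge to one value (`exists_forall_tendsto_of_perturbed_consensus`). Up to an integrable
correction, their maximum decreases and their minimum increases. Every node is at least about half
the spread away from one of these two extremes, and `forall_gap_or_forall_gap` spreads one of the
two kinds of gap to all nodes within a bounded time, so the spread contracts by a fixed factor.

The last entry of `sᵢ` is `ξᵢ` minus a combination of the others, so the first `n` entries form a
companion system driven by `ξᵢ`. It is Hurwitz by the assumption on the polynomial, and its
convergent input yields a limit determined by that of `ξᵢ` (`HurwitzMatrix.tendsto_of_tendsto`),
hence common to all agents. Finally `xᵢ` has the limit of `sᵢ`. -/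

noncomputable section

namespace HighOrderConsensus

/-! ### Differential inequalities for right derivatives -/

theorem add_mul_sub_le_of_hasDerivWithinAt_Ici {f f' : ℝ → ℝ} {a b k : ℝ} (hab : a ≤ b)
    (hc : ContinuousOn f (Icc a b))
    (hd : ∀ t ∈ Ico a b, HasDerivWithinAt f (f' t) (Ici t) t)
    (hk : ∀ t ∈ Ico a b, k ≤ f' t) : f a + k * (b - a) ≤ f b := by
  have hB : ∀ t, HasDerivAt (fun t => -f a - k * (t - a)) (-k) t := fun t => by
    simpa using (((hasDerivAt_id t).sub_const a).const_mul k).const_sub (-f a)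
  have := image_le_of_deriv_right_le_deriv_boundary (f := fun t => -f t) (f' := fun t => -f' t)
    (B := fun t => -f a - k * (t - a)) (B' := fun _ => -k) hc.neg
    (fun t ht => (hd t ht).neg) (by simp) (fun t _ => (hB t).continuousAt.continuousWithinAt)
    (fun t _ => (hB t).hasDerivWithinAt) (fun t ht => neg_le_neg (hk t ht)) (right_mem_Icc.2 hab)
  linarith

/-- The families `g` with `gᵢ' ≥ ∑ⱼ wᵢⱼ (gⱼ - gᵢ)` on `[t₀, ∞)`, in the sense of right
derivatives. -/
structure IsSupersolution {ι : Type*} [Fintype ι] (w : ℝ → ι → ι → ℝ) (t₀ : ℝ)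
    (g : ι → ℝ → ℝ) : Prop where
  continuousOn : ∀ i, ContinuousOn (g i) (Ici t₀)
  deriv : ∀ i t, t₀ ≤ t → ∃ g', ∑ j, w t i j * (g j t - g i t) ≤ g' ∧
    HasDerivWithinAt (g i) g' (Ici t) t

namespace IsSupersolution

variable {ι : Type*} [Fintype ι] {w : ℝ → ι → ι → ℝ} {t₀ : ℝ} {g : ι → ℝ → ℝ}

theorem mono (hg : IsSupersolution w t₀ g) {t₁ : ℝ} (h : t₀ ≤ t₁) : IsSupersolution w t₁ g :=
  ⟨fun i => (hg.continuousOn i).mono (Ici_subset_Ici.2 h),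
    fun i t ht => hg.deriv i t (h.trans ht)⟩

/-- Minimum principle: at a first contact with a strictly decreasing barrier, the touching component
is below no barrier value of the others, so its derivative is nonnegative and it cannot cross. -/
theorem nonneg (hg : IsSupersolution w t₀ g) (hw : ∀ t i j, 0 ≤ w t i j)
    (h0 : ∀ i, 0 ≤ g i t₀) {t : ℝ} (ht : t₀ ≤ t) (i : ι) : 0 ≤ g i t := by
  have key : ∀ ε > 0, -(ε * (1 + (t - t₀))) ≤ g i t := by
    intro ε hε
    let s : Set ℝ := {u | ∀ i, -(ε * (1 + (u - t₀))) ≤ g i u}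
    have hs : IsClosed (s ∩ Icc t₀ t) := by
      have : s ∩ Icc t₀ t = ⋂ i, {u ∈ Icc t₀ t | -(ε * (1 + (u - t₀))) ≤ g i u} ∩ Icc t₀ t := by
        ext u
        simp only [s, mem_inter_iff, mem_ofPred_eq, mem_iInter]
        exact ⟨fun h j => ⟨⟨h.2, h.1 j⟩, h.2⟩, fun h => ⟨fun j => (h j).1.2, (h i).2⟩⟩
      rw [this]
      exact isClosed_iInter fun j => (isClosed_Icc.isClosed_le (by fun_prop)
        ((hg.continuousOn j).mono Icc_subset_Ici_self)).inter isClosed_Icc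
    refine hs.Icc_subset_of_forall_exists_gt (fun j => ?_) ?_ (right_mem_Icc.2 ht) i
    · have := h0 j
      simp only [sub_self, add_zero, mul_one]
      linarith
    · rintro u ⟨hu, hu1, -⟩ v hv
      have hev : ∀ j, ∀ᶠ r in 𝓝[>] u, -(ε * (1 + (r - t₀))) ≤ g j r := by
        intro j
        rcases (hu j).lt_or_eq with hlt | heq
        · have h1 : Tendsto (g j) (𝓝[>] u) (𝓝 (g j u)) :=
            ((hg.continuousOn j) u hu1).mono_left
              (nhdsWithin_mono u (Ioi_subset_Ici_self.trans (Ici_subset_Ici.2 hu1)))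
          have h2 : Tendsto (fun r => -(ε * (1 + (r - t₀)))) (𝓝[>] u)
              (𝓝 (-(ε * (1 + (u - t₀))))) :=
            (Continuous.tendsto (by fun_prop) u).mono_left nhdsWithin_le_nhds
          exact (h2.eventually_lt h1 hlt).mono fun _ => le_of_lt
        · obtain ⟨g', hg', hd⟩ := hg.deriv j u hu1
          have h0' : 0 ≤ g' := le_trans (Finset.sum_nonneg fun l _ =>
            mul_nonneg (hw u j l) (by have := hu l; rw [← heq]; linarith)) hg'
          have hsl := hasDerivWithinAt_iff_tendsto_slope' (self_notMem_Ioi) |>.1 hd.Ioi_of_Ici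
          have : ∀ᶠ r in 𝓝[>] u, -ε < slope (g j) u r :=
            hsl.eventually (lt_mem_nhds (by linarith))
          filter_upwards [this, self_mem_nhdsWithin] with r hr hru
          have hru : 0 < r - u := sub_pos.2 hru
          rw [slope_def_field, lt_div_iff₀ hru] at hr
          rw [← heq] at hr
          linarith
      have hall := (eventually_all.2 hev).and (Ioc_mem_nhdsGT hv)
      obtain ⟨r, hr, hr'⟩ := hall.exists
      exact ⟨r, hr, hr'⟩
  by_contra! hneg
  have hpos : 0 < 1 + (t - t₀) := by linarith
  -- This `ε` puts the barrier at time `t` at `g i t / 2`, above the negative value `g i t`.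
  have := key (-g i t / (2 * (1 + (t - t₀)))) (by apply div_pos <;> linarith)
  have h2 : -g i t / (2 * (1 + (t - t₀))) * (1 + (t - t₀)) = -g i t / 2 := by field_simp
  rw [h2] at this
  linarith

variable {Λ : ℝ}

/-- Integrated form of `gᵢ' ≥ -Λ gᵢ + wᵢⱼ gⱼ`. -/
theorem exp_mul_add_le (hg : IsSupersolution w t₀ g) (hw : ∀ t i j, 0 ≤ w t i j)
    (hΛ : ∀ t i, ∑ j, w t i j ≤ Λ) (hΛ0 : 0 ≤ Λ) (h0 : ∀ i, 0 ≤ g i t₀) {a b : ℝ} (ha : t₀ ≤ a)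
    (hab : a ≤ b) (i j : ι) {k : ℝ} (hk0 : 0 ≤ k) (hk : ∀ t ∈ Ico a b, k ≤ w t i j * g j t) :
    Real.exp (-(Λ * (b - a))) * (g i a + k * (b - a)) ≤ g i b := by
  choose! g' hg' hd using hg.deriv i
  have hE : ∀ t, HasDerivAt (fun t => Real.exp (Λ * (t - a))) (Real.exp (Λ * (t - a)) * Λ) t :=
    fun t => by simpa using (((hasDerivAt_id t).sub_const a).const_mul Λ).exp
  have := add_mul_sub_le_of_hasDerivWithinAt_Ici (f := fun t => Real.exp (Λ * (t - a)) * g i t)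
    -- With the integrating factor, the derivative is at least `exp (Λ (t - a)) * k`, hence at least
    -- `k`.
    (f' := fun t => Real.exp (Λ * (t - a)) * Λ * g i t + Real.exp (Λ * (t - a)) * g' t)
    (k := k) hab
    (ContinuousOn.mul (by fun_prop)
      ((hg.continuousOn i).mono (Icc_subset_Ici_self.trans (Ici_subset_Ici.2 ha))))
    (fun t ht => (hE t).hasDerivWithinAt.mul (hd t (ha.trans ht.1)))
    (fun t ht => by
      have hta := ha.trans ht.1
      have hn := fun l => hg.nonneg hw h0 hta l
      have h1 := hg' t hta
      have h2 : ∑ l, w t i l * (g l t - g i t) = ∑ l, w t i l * g l t - (∑ l, w t i l) * g i t := by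
        rw [Finset.sum_mul, ← Finset.sum_sub_distrib]
        exact Finset.sum_congr rfl fun l _ => by ring
      have h3 : w t i j * g j t ≤ ∑ l, w t i l * g l t :=
        Finset.single_le_sum (f := fun l => w t i l * g l t)
          (fun l _ => mul_nonneg (hw t i l) (hn l)) (Finset.mem_univ j)
      have h4 := mul_le_mul_of_nonneg_right (hΛ t i) (hn i)
      have h5 : k ≤ Λ * g i t + g' t := by linarith [hk t ht]
      have h6 : 1 ≤ Real.exp (Λ * (t - a)) :=
        Real.one_le_exp (mul_nonneg hΛ0 (sub_nonneg.2 ht.1))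
      calc k ≤ Λ * g i t + g' t := h5
        _ ≤ Real.exp (Λ * (t - a)) * (Λ * g i t + g' t) :=
          le_mul_of_one_le_left (hk0.trans h5) h6
        _ = _ := by ring)
  simp only [sub_self, mul_zero, Real.exp_zero, one_mul] at this
  calc _ ≤ Real.exp (-(Λ * (b - a))) * (Real.exp (Λ * (b - a)) * g i b) := by gcongr
    _ = g i b := by rw [← mul_assoc, ← Real.exp_add]; simp

theorem exp_mul_le (hg : IsSupersolution w t₀ g) (hw : ∀ t i j, 0 ≤ w t i j)
    (hΛ : ∀ t i, ∑ j, w t i j ≤ Λ) (hΛ0 : 0 ≤ Λ) (h0 : ∀ i, 0 ≤ g i t₀) {a b : ℝ} (ha : t₀ ≤ a)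
    (hab : a ≤ b) (i : ι) : Real.exp (-(Λ * (b - a))) * g i a ≤ g i b := by
  simpa using hg.exp_mul_add_le hw hΛ hΛ0 h0 ha hab i i le_rfl
    fun t ht => mul_nonneg (hw _ _ _) (hg.nonneg hw h0 (ha.trans ht.1) i)

end IsSupersolution

/-- The factor by which a gap shrinks at most while it propagates along an edge of weight at least
`κ` which is active for a time `d` inside a window of length `L`. -/
def gapFactor (Λ κ d L : ℝ) : ℝ := Real.exp (-(Λ * L)) * Real.exp (-(Λ * L)) * min 1 (κ * d)

/-- Every window of length `L` has a center `c`: each proper set of nodes that contains `c` is left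
by an edge of weight at least `κ` that is active for a time `d` in the window. -/
def HasPersistentCenters {ι : Type*} (w : ℝ → ι → ι → ℝ) (κ d L : ℝ) : Prop :=
  ∀ t, 0 ≤ t → ∃ c, ∀ H : Set ι, c ∈ H → H ≠ univ → ∃ j ∈ H, ∃ i ∉ H, ∃ r, t ≤ r ∧
    r + d ≤ t + L ∧ ∀ τ ∈ Ico r (r + d), κ ≤ w τ i j

/-! ### Propagation of gaps and contraction of the spread -/

section Contraction

variable {ι : Type*} [Fintype ι] {w : ℝ → ι → ι → ℝ} {t₀ Λ κ d L : ℝ} {g h : ι → ℝ → ℝ}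

theorem gapFactor_pos (hκ : 0 < κ) (hd : 0 < d) : 0 < gapFactor Λ κ d L := by
  unfold gapFactor; positivity

/-- The `min 1` in the factor serves here: the same loss also covers nodes that merely keep their
gap. -/
theorem gapFactor_mul_le (hΛ0 : 0 ≤ Λ) (hL : 0 ≤ L) {c : ℝ} (hc : 0 ≤ c) :
    gapFactor Λ κ d L * c ≤ Real.exp (-(Λ * L)) * c := by
  have h1 : Real.exp (-(Λ * L)) ≤ 1 := Real.exp_le_one_iff.2 (by nlinarith)
  have h2 : min 1 (κ * d) ≤ 1 := min_le_left _ _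
  have h3 := Real.exp_pos (-(Λ * L))
  refine mul_le_mul_of_nonneg_right ?_ hc
  unfold gapFactor
  rw [mul_assoc]
  refine mul_le_of_le_one_right h3.le ?_
  calc _ ≤ Real.exp (-(Λ * L)) * 1 := by gcongr
    _ ≤ 1 := by linarith

namespace IsSupersolution

theorem gapFactor_mul_le_of_le (hg : IsSupersolution w t₀ g) (hw : ∀ t i j, 0 ≤ w t i j)
    (hΛ : ∀ t i, ∑ j, w t i j ≤ Λ) (hΛ0 : 0 ≤ Λ) (hL : 0 ≤ L) (h0 : ∀ i, 0 ≤ g i t₀)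
    {c : ℝ} (hc : 0 ≤ c) {i : ι} (hi : c ≤ g i t₀) :
    gapFactor Λ κ d L * c ≤ g i (t₀ + L) := by
  refine (gapFactor_mul_le hΛ0 hL hc).trans ?_
  have := hg.exp_mul_le hw hΛ hΛ0 h0 le_rfl (le_add_of_nonneg_right hL) i
  rw [add_sub_cancel_left] at this
  exact le_trans (by gcongr) this

/-- One exponential pays for the decay of the source `j` until the edge has done its work, `κ * d`
is the transfer along the edge, and the other exponential pays for the decay of the target `i` until
the end of the window. -/
theorem gapFactor_mul_le_of_edge (hg : IsSupersolution w t₀ g) (hw : ∀ t i j, 0 ≤ w t i j)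
    (hΛ : ∀ t i, ∑ j, w t i j ≤ Λ) (hΛ0 : 0 ≤ Λ) (hκ : 0 ≤ κ) (hd : 0 ≤ d)
    (h0 : ∀ i, 0 ≤ g i t₀)
    {c : ℝ} (hc : 0 ≤ c) {i j : ι} (hj : c ≤ g j t₀) {r : ℝ} (hr : t₀ ≤ r)
    (hrL : r + d ≤ t₀ + L) (hedge : ∀ τ ∈ Ico r (r + d), κ ≤ w τ i j) :
    gapFactor Λ κ d L * c ≤ g i (t₀ + L) := by
  have hk : ∀ τ ∈ Ico r (r + d), κ * (Real.exp (-(Λ * L)) * c) ≤ w τ i j * g j τ := by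
    intro τ hτ
    have h1 := hg.exp_mul_le hw hΛ hΛ0 h0 le_rfl (hr.trans hτ.1) j
    refine mul_le_mul (hedge τ hτ) (le_trans ?_ h1) (by positivity) (hw _ _ _)
    have : τ - t₀ ≤ L := by linarith [hτ.2]
    gcongr
  have h2 := hg.exp_mul_add_le hw hΛ hΛ0 h0 hr (le_add_of_nonneg_right hd) i j (by positivity) hk
  have h3 := hg.exp_mul_le hw hΛ hΛ0 h0 (b := t₀ + L) (by linarith : t₀ ≤ r + d) hrL i
  have h4 := hg.nonneg hw h0 hr i
  refine le_trans ?_ h3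
  calc gapFactor Λ κ d L * c
      ≤ Real.exp (-(Λ * L)) * Real.exp (-(Λ * L)) * (κ * d) * c := by
        unfold gapFactor; gcongr; exact min_le_right _ _
    _ = Real.exp (-(Λ * L)) * (κ * (Real.exp (-(Λ * L)) * c) * d) := by ring
    _ ≤ Real.exp (-(Λ * (t₀ + L - r))) * (κ * (Real.exp (-(Λ * L)) * c) * d) := by
        have : t₀ + L - r ≤ L := by linarith
        gcongr
    _ = Real.exp (-(Λ * (t₀ + L - (r + d)))) * (Real.exp (-(Λ * (r + d - r))) *
          (κ * (Real.exp (-(Λ * L)) * c) * d)) := by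
        have : Real.exp (-(Λ * (t₀ + L - r))) =
            Real.exp (-(Λ * (t₀ + L - (r + d)))) * Real.exp (-(Λ * (r + d - r))) := by
          rw [← Real.exp_add]; ring_nf
        rw [this, mul_assoc]
    _ ≤ _ := by
        refine mul_le_mul_of_nonneg_left (le_trans ?_ h2) (Real.exp_pos _).le
        refine mul_le_mul_of_nonneg_left ?_ (Real.exp_pos _).le
        rw [add_sub_cancel_left]; linarith

end IsSupersolution

open Classical in
/-- Two families of gaps which together cover all nodes: after `card ι` windows one of them
covers all nodes. -/
theorem forall_gap_or_forall_gap (hw : ∀ t i j, 0 ≤ w t i j)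
    (hΛ : ∀ t i, ∑ j, w t i j ≤ Λ) (hΛ0 : 0 ≤ Λ) (hκ : 0 < κ) (hd : 0 < d) (hL : 0 ≤ L)
    (hconn : HasPersistentCenters w κ d L) (ht₀ : 0 ≤ t₀)
    (hg : IsSupersolution w t₀ g) (hh : IsSupersolution w t₀ h)
    (hg0 : ∀ i, 0 ≤ g i t₀) (hh0 : ∀ i, 0 ≤ h i t₀) {c : ℝ} (hc : 0 ≤ c)
    (hcov : ∀ i, c ≤ g i t₀ ∨ c ≤ h i t₀) :
    (∀ i, gapFactor Λ κ d L ^ Fintype.card ι * c ≤ g i (t₀ + Fintype.card ι * L)) ∨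
    (∀ i, gapFactor Λ κ d L ^ Fintype.card ι * c ≤ h i (t₀ + Fintype.card ι * L)) := by
  set η := gapFactor Λ κ d L with hη
  have hη0 : 0 < η := gapFactor_pos hκ hd
  -- Nodes whose gap is still `η ^ k * c` after `k` windows. The center may change with the window,
  -- so a single such set could miss it; two sets that cover all nodes cannot.
  let H (g : ι → ℝ → ℝ) (k : ℕ) : Finset ι := Finset.univ.filter fun i => η ^ k * c ≤ g i (t₀ + k * L)
  have hstep : ∀ {g : ι → ℝ → ℝ}, IsSupersolution w t₀ g → (∀ i, 0 ≤ g i t₀) →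
      ∀ k : ℕ, H g k ⊆ H g (k + 1) := by
    intro g hg hg0 k i hi
    have hk : t₀ ≤ t₀ + k * L := le_add_of_nonneg_right (by positivity)
    simp only [H, Finset.mem_filter, Finset.mem_univ, true_and] at hi ⊢
    have := (hg.mono hk).gapFactor_mul_le_of_le (κ := κ) (d := d) hw hΛ hΛ0 hL
      (hg.nonneg hw hg0 hk) (by positivity) hi
    rw [← hη] at this
    have e1 : t₀ + ((k + 1 : ℕ) : ℝ) * L = t₀ + k * L + L := by push_cast; ring
    rw [e1, pow_succ', mul_assoc]
    exact this
  have hgrow : ∀ {g : ι → ℝ → ℝ}, IsSupersolution w t₀ g → (∀ i, 0 ≤ g i t₀) → ∀ (k : ℕ) (e : ι),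
      (∀ H : Set ι, e ∈ H → H ≠ univ → ∃ j ∈ H, ∃ i ∉ H, ∃ r, t₀ + k * L ≤ r ∧
        r + d ≤ t₀ + k * L + L ∧ ∀ τ ∈ Ico r (r + d), κ ≤ w τ i j) →
      e ∈ H g k → H g k ≠ Finset.univ → (H g k).card + 1 ≤ (H g (k + 1)).card := by
    intro g hg hg0 k e he heH hne
    have hk : t₀ ≤ t₀ + k * L := le_add_of_nonneg_right (by positivity)
    obtain ⟨j, hj, i, hi, r, hr, hrL, hedge⟩ := he (H g k) heH (by simpa using hne)
    refine Finset.card_lt_card ((hstep hg hg0 k).ssubset_of_mem_notMem (a := i) ?_ hi)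
    simp only [H, Finset.mem_filter, Finset.mem_univ, true_and, SetLike.mem_coe] at hj ⊢
    have := (hg.mono hk).gapFactor_mul_le_of_edge hw hΛ hΛ0 hκ.le hd.le
      (hg.nonneg hw hg0 hk) (by positivity) hj hr hrL hedge
    rw [← hη] at this
    have e1 : t₀ + ((k + 1 : ℕ) : ℝ) * L = t₀ + k * L + L := by push_cast; ring
    rw [e1, pow_succ', mul_assoc]
    exact this
  -- The cover gives total cardinality at least `card ι` at the start, and each window adds at least
  -- one node to the set containing its center, unless a set is already full.
  have main : ∀ k : ℕ, H g k ∪ H h k = Finset.univ ∧ (H g k = Finset.univ ∨ H h k = Finset.univ ∨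
      Fintype.card ι + k ≤ (H g k).card + (H h k).card) := by
    intro k
    induction k with
    | zero =>
      have : H g 0 ∪ H h 0 = Finset.univ := by
        ext i
        simpa [H] using hcov i
      refine ⟨this, .inr (.inr ?_)⟩
      rw [add_zero, ← Finset.card_univ, ← this]
      exact Finset.card_union_le _ _
    | succ k ih =>
      obtain ⟨hU, ih⟩ := ih
      have sg := hstep hg hg0 k
      have sh := hstep hh hh0 k
      refine ⟨Finset.univ_subset_iff.1 (hU ▸ Finset.union_subset_union sg sh), ?_⟩
      by_cases h1 : H g k = Finset.univ
      · exact .inl (Finset.univ_subset_iff.1 (h1 ▸ sg))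
      by_cases h2 : H h k = Finset.univ
      · exact .inr (.inl (Finset.univ_subset_iff.1 (h2 ▸ sh)))
      have ih : Fintype.card ι + k ≤ (H g k).card + (H h k).card := by tauto
      obtain ⟨e, he⟩ := hconn (t₀ + k * L) (by positivity)
      have cg := Finset.card_le_card sg
      have ch := Finset.card_le_card sh
      have : e ∈ H g k ∪ H h k := hU ▸ Finset.mem_univ e
      refine .inr (.inr ?_)
      rcases Finset.mem_union.1 this with h3 | h3
      · have := hgrow hg hg0 k e he h3 h1
        omega
      · have := hgrow hh hh0 k e he h3 h2
        omega
  have conv : ∀ {g : ι → ℝ → ℝ}, H g (Fintype.card ι) = Finset.univ →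
      ∀ i, η ^ Fintype.card ι * c ≤ g i (t₀ + Fintype.card ι * L) := by
    intro g hg i
    have : i ∈ H g (Fintype.card ι) := hg ▸ Finset.mem_univ i
    simpa [H] using this
  rcases (main (Fintype.card ι)).2 with h1 | h1 | h1
  · exact .inl (conv h1)
  · exact .inr (conv h1)
  -- After `card ι` windows the cardinalities sum to at least `2 * card ι`, so both sets are full.
  · refine .inl (conv (Finset.card_eq_iff_eq_univ _ |>.1 (le_antisymm (Finset.card_le_univ _) ?_)))
    have := Finset.card_le_univ (H h (Fintype.card ι))
    omega

/-- Perturbed first-order consensus: with persistent centers and exponentially decaying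
perturbations, all agents converge to a common value. -/
theorem exists_forall_tendsto_of_perturbed_consensus [Nonempty ι] (hw : ∀ t i j, 0 ≤ w t i j)
    (hΛ : ∀ t i, ∑ j, w t i j ≤ Λ) (hΛ0 : 0 ≤ Λ) (hκ : 0 < κ) (hd : 0 < d) (hL : 0 < L)
    (hconn : HasPersistentCenters w κ d L) {ξ δ : ι → ℝ → ℝ} {D ε : ℝ} (hε : 0 < ε)
    (hξc : ∀ i, ContinuousOn (ξ i) (Ici 0))
    (hξ : ∀ i t, 0 ≤ t →
      HasDerivWithinAt (ξ i) (∑ j, w t i j * (ξ j t - ξ i t) + δ i t) (Ici t) t)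
    (hδ : ∀ i t, 0 ≤ t → |δ i t| ≤ D * Real.exp (-(ε * t))) :
    ∃ ξstar, ∀ i, Tendsto (ξ i) atTop (𝓝 ξstar) := by
  have hD : 0 ≤ D := by
    have := (abs_nonneg _).trans (hδ (Classical.arbitrary ι) 0 le_rfl)
    simpa using this
  -- `E t` is the integral of `D * exp (-(ε τ))` over `τ ≥ t`: its derivative absorbs the
  -- perturbation, so both shifted gaps below are supersolutions.
  let E : ℝ → ℝ := fun t => D / ε * Real.exp (-(ε * t))
  have hE0 : ∀ t, 0 ≤ E t := fun t => by positivity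
  have hE : ∀ t, HasDerivAt E (-(D * Real.exp (-(ε * t)))) t := fun t => by
    have := (((hasDerivAt_id t).const_mul ε).neg.exp).const_mul (D / ε)
    refine this.congr_deriv ?_
    simp only [id, Pi.neg_apply]
    field_simp
  have hEc : Continuous E := by fun_prop
  have hsuper : ∀ (u t₀ : ℝ), 0 ≤ t₀ → IsSupersolution w t₀ fun i t => u - ξ i t - E t := by
    refine fun u t₀ ht₀ => ⟨fun i => ?_, fun i t ht => ⟨_, ?_,
      ((hξ i t (ht₀.trans ht)).const_sub u).sub (hE t).hasDerivWithinAt⟩⟩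
    · exact (continuousOn_const.sub ((hξc i).mono (Ici_subset_Ici.2 ht₀))).sub hEc.continuousOn
    · have h1 : ∑ j, w t i j * (u - ξ j t - E t - (u - ξ i t - E t))
          = -∑ j, w t i j * (ξ j t - ξ i t) := by
        rw [← Finset.sum_neg_distrib]
        exact Finset.sum_congr rfl fun j _ => by ring
      rw [h1]
      linarith [(abs_le.1 (hδ i t (ht₀.trans ht))).2]
  have hsub : ∀ (l t₀ : ℝ), 0 ≤ t₀ → IsSupersolution w t₀ fun i t => ξ i t - E t - l := by
    refine fun u t₀ ht₀ => ⟨fun i => ?_, fun i t ht => ⟨_, ?_,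
      ((hξ i t (ht₀.trans ht)).sub (hE t).hasDerivWithinAt).sub_const u⟩⟩
    · exact (((hξc i).mono (Ici_subset_Ici.2 ht₀)).sub hEc.continuousOn).sub continuousOn_const
    · have h1 : ∑ j, w t i j * (ξ j t - E t - u - (ξ i t - E t - u))
          = ∑ j, w t i j * (ξ j t - ξ i t) :=
        Finset.sum_congr rfl fun j _ => by ring
      rw [h1]
      linarith [(abs_le.1 (hδ i t (ht₀.trans ht))).1]
  let u : ℝ → ℝ := fun t => Finset.univ.sup' Finset.univ_nonempty (fun i => ξ i t) + E t
  let l : ℝ → ℝ := fun t => Finset.univ.inf' Finset.univ_nonempty (fun i => ξ i t) - E t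
  have hu : ∀ i t, ξ i t + E t ≤ u t := fun i t =>
    add_le_add_left (Finset.le_sup' (fun i => ξ i t) (Finset.mem_univ i)) _
  have hl : ∀ i t, l t ≤ ξ i t - E t := fun i t =>
    sub_le_sub_right (Finset.inf'_le (fun i => ξ i t) (Finset.mem_univ i)) _
  have hu' : ∀ t b, (∀ i, ξ i t + E t ≤ b) → u t ≤ b := fun t b hb =>
    le_sub_iff_add_le.1 (Finset.sup'_le _ _ fun i _ => le_sub_iff_add_le.2 (hb i))
  have hl' : ∀ t b, (∀ i, b ≤ ξ i t - E t) → b ≤ l t := fun t b hb =>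
    le_sub_iff_add_le.2 (Finset.le_inf' _ _ fun i _ => le_sub_iff_add_le.1 (hb i))
  have hug : ∀ t i, 0 ≤ u t - ξ i t - E t := fun t i => by linarith [hu i t]
  have hlg : ∀ t i, 0 ≤ ξ i t - E t - l t := fun t i => by linarith [hl i t]
  have hup : ∀ t, 0 ≤ t → ∀ s, t ≤ s → ∀ i, ξ i s + E s ≤ u t := fun t ht s hs i => by
    linarith [(hsuper (u t) t ht).nonneg hw (hug t) hs i]
  have hlow : ∀ t, 0 ≤ t → ∀ s, t ≤ s → ∀ i, l t ≤ ξ i s - E s := fun t ht s hs i => by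
    linarith [(hsub (l t) t ht).nonneg hw (hlg t) hs i]
  have hua : ∀ t, 0 ≤ t → ∀ s, t ≤ s → u s ≤ u t := fun t ht s hs => hu' _ _ (hup t ht s hs)
  have hla : ∀ t, 0 ≤ t → ∀ s, t ≤ s → l t ≤ l s := fun t ht s hs => hl' _ _ (hlow t ht s hs)
  have hlu : ∀ t, l t ≤ u t := fun t => by
    have i := Classical.arbitrary ι
    linarith [hu i t, hl i t, hE0 t]
  set P : ℝ := Fintype.card ι * L
  have hP0 : 0 < P := by
    have : 0 < Fintype.card ι := Fintype.card_pos
    positivity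
  set ρ := gapFactor Λ κ d L ^ Fintype.card ι
  have hρ0 : 0 < ρ := pow_pos (gapFactor_pos hκ hd) _
  -- At each node the distances to `u t` and to `l t`, each reduced by `E t`, add up to twice `(u t
  -- - l t) / 2 - E t`, so one of them is at least this value.
  have hcontr : ∀ t, 0 ≤ t → u (t + P) - l (t + P) ≤ u t - l t - ρ * ((u t - l t) / 2 - E t) := by
    intro t ht
    have hle : t ≤ t + P := by linarith
    have hc : 0 ≤ (u t - l t) / 2 - E t := by
      have i := Classical.arbitrary ι
      linarith [hu i t, hl i t]
    rcases forall_gap_or_forall_gap hw hΛ hΛ0 hκ hd hL.le hconn ht (hsuper (u t) t ht)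
      (hsub (l t) t ht) (hug t) (hlg t) hc (fun i => by
        by_contra! hcon
        linarith [hcon.1, hcon.2]) with h1 | h1
    · have := hu' (t + P) (u t - ρ * ((u t - l t) / 2 - E t)) fun i => by linarith [h1 i]
      linarith [hla t ht _ hle]
    · have := hl' (t + P) (l t + ρ * ((u t - l t) / 2 - E t)) fun i => by linarith [h1 i]
      linarith [hua t ht _ hle]
  have hk0 : ∀ k : ℕ, (0 : ℝ) ≤ k * P := fun k => by positivity
  have hkk : ∀ {k k' : ℕ}, k ≤ k' → (k : ℝ) * P ≤ k' * P := fun h => by gcongr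
  have hlub : ∀ k : ℕ, l (k * P) ≤ u 0 := fun k =>
    (hlu _).trans (hua 0 le_rfl _ (hk0 k))
  have hulb : ∀ k : ℕ, l 0 ≤ u (k * P) := fun k =>
    (hla 0 le_rfl _ (hk0 k)).trans (hlu _)
  have hut := tendsto_atTop_ciInf (f := fun k : ℕ => u (k * P))
    (fun k k' h => hua _ (hk0 k) _ (hkk h)) ⟨l 0, by rintro _ ⟨k, rfl⟩; exact hulb k⟩
  have hlt := tendsto_atTop_ciSup (f := fun k : ℕ => l (k * P))
    (fun k k' h => hla _ (hk0 k) _ (hkk h)) ⟨u 0, by rintro _ ⟨k, rfl⟩; exact hlub k⟩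
  set us := ⨅ k : ℕ, u (k * P)
  set ls := ⨆ k : ℕ, l (k * P)
  have hkP : Tendsto (fun k : ℕ => (k : ℝ) * P) atTop atTop :=
    tendsto_natCast_atTop_atTop.atTop_mul_const hP0
  have hEt : Tendsto E atTop (𝓝 0) := by
    have h1 : Tendsto (fun t : ℝ => Real.exp (-(ε * t))) atTop (𝓝 0) :=
      Real.tendsto_exp_neg_atTop_nhds_zero.comp (tendsto_id.const_mul_atTop hε)
    simpa using h1.const_mul (D / ε)
  -- The contraction estimate in the limit, where `E` vanishes; as `ρ > 0`, it forces `us ≤ ls`.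
  have hlim : us - ls ≤ us - ls - ρ * ((us - ls) / 2 - 0) := by
    refine le_of_tendsto_of_tendsto' ((hut.sub hlt).comp (tendsto_add_atTop_nat 1))
      ((hut.sub hlt).sub ((((hut.sub hlt).div_const 2).sub (hEt.comp hkP)).const_mul ρ))
      fun k => ?_
    have := hcontr (k * P) (hk0 k)
    simp only [Function.comp_apply, Nat.cast_add, Nat.cast_one, add_mul, one_mul]
    exact this
  have hle : ls ≤ us := le_of_tendsto_of_tendsto' hlt hut fun k => hlu _
  have heq : ls = us := by nlinarith
  refine ⟨us, fun i => ?_⟩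
  rw [Metric.tendsto_atTop]
  intro e he
  obtain ⟨k, hk1, hk2⟩ := ((hut.eventually (gt_mem_nhds (by linarith : us < us + e))).and
    (hlt.eventually (lt_mem_nhds (by linarith : us - e < ls)))).exists
  refine ⟨k * P, fun t ht => ?_⟩
  have h1 := hup _ (hk0 k) t ht i
  have h2 := hlow _ (hk0 k) t ht i
  rw [Real.dist_eq, abs_lt]
  constructor <;> linarith [hE0 t]

end Contraction

/-! ### Linear systems with vanishing input -/

section Complex

variable {E : Type*} [NormedAddCommGroup E] [NormedSpace ℂ E]

theorem tendsto_zero_of_hasDerivWithinAt_smul_add {z : ℂ} (hz : z.re < 0) {f g : ℝ → E}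
    (hc : ContinuousOn f (Ici 0))
    (hf : ∀ t, 0 ≤ t → HasDerivWithinAt f (z • f t + g t) (Ici t) t)
    (hg : Tendsto g atTop (𝓝 0)) : Tendsto f atTop (𝓝 0) := by
  set μ := -z.re with hμ
  have hμ0 : 0 < μ := by linarith
  have hnorm : ∀ t : ℝ, ‖Complex.exp (-z * t)‖ = Real.exp (μ * t) := fun t => by
    rw [Complex.norm_exp]; simp [hμ]
  have hexp : ∀ t : ℝ, HasDerivAt (fun t : ℝ => Complex.exp (-z * (t : ℂ)))
      (Complex.exp (-z * (t : ℂ)) * -z) t := fun t => by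
    have := ((Complex.ofRealCLM.hasDerivAt (x := t)).const_mul (-z)).cexp
    simpa using this
  let h : ℝ → E := fun t => Complex.exp (-z * t) • f t
  have hh : ∀ t : ℝ, 0 ≤ t → HasDerivWithinAt h (Complex.exp (-z * t) • g t) (Ici t) t := by
    intro t ht
    refine ((hexp t).hasDerivWithinAt.smul (hf t ht)).congr_deriv ?_
    module
  have hhc : ContinuousOn h (Ici 0) :=
    ContinuousOn.smul (fun t _ => (hexp t).continuousAt.continuousWithinAt) hc
  rw [Metric.tendsto_atTop]
  intro ε hε
  -- An input of norm at most `ε / 2 * μ`, damped at rate `μ`, contributes at most `ε / 2`.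
  obtain ⟨T, hT⟩ := eventually_atTop.1 (hg.eventually_mem
    (Metric.closedBall_mem_nhds (0 : E) (by positivity : 0 < ε / 2 * μ)))
  simp only [mem_closedBall_zero_iff] at hT
  set T₀ := max T 0
  have hT₀ : 0 ≤ T₀ := le_max_right _ _
  have hbound : ∀ t, T₀ ≤ t →
      ‖h t‖ ≤ ‖h T₀‖ + ε / 2 * (Real.exp (μ * t) - Real.exp (μ * T₀)) := by
    intro t ht
    refine image_norm_le_of_norm_deriv_right_le_deriv_boundary (f := h)
      (B := fun t => ‖h T₀‖ + ε / 2 * (Real.exp (μ * t) - Real.exp (μ * T₀)))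
      (B' := fun t => ε / 2 * (Real.exp (μ * t) * μ))
      (hhc.mono (Icc_subset_Ici_self.trans (Ici_subset_Ici.2 hT₀)))
      (fun t ht => hh t (hT₀.trans ht.1)) (by simp) (fun t => ?_) (fun t ht => ?_)
      (right_mem_Icc.2 ht)
    · have := (((hasDerivAt_id t).const_mul μ).exp.sub_const (Real.exp (μ * T₀))).const_mul (ε / 2)
      simpa using this.const_add ‖h T₀‖
    · rw [norm_smul, hnorm]
      have := hT t ((le_max_left _ _).trans ht.1)
      calc _ ≤ Real.exp (μ * t) * (ε / 2 * μ) := by gcongr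
        _ = _ := by ring
  have hlim : Tendsto (fun t : ℝ => Real.exp (-(μ * t)) * ‖h T₀‖) atTop (𝓝 0) := by
    have h1 : Tendsto (fun t : ℝ => Real.exp (-(μ * t))) atTop (𝓝 0) :=
      Real.tendsto_exp_neg_atTop_nhds_zero.comp (tendsto_id.const_mul_atTop hμ0)
    simpa using h1.mul_const ‖h T₀‖
  obtain ⟨T₁, hT₁⟩ := eventually_atTop.1 (hlim.eventually (gt_mem_nhds (half_pos hε)))
  refine ⟨max T₁ T₀, fun t ht => ?_⟩
  have h1 := hT₁ t ((le_max_left _ _).trans ht)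
  have h2 := hbound t ((le_max_right _ _).trans ht)
  have h3 : Real.exp (-(μ * t)) * Real.exp (μ * t) = 1 := by rw [← Real.exp_add]; simp
  have h4 : ‖h t‖ = Real.exp (μ * t) * ‖f t‖ := by rw [norm_smul, hnorm]
  rw [dist_zero_right]
  calc ‖f t‖ = Real.exp (-(μ * t)) * ‖h t‖ := by rw [h4, ← mul_assoc, h3, one_mul]
    _ ≤ Real.exp (-(μ * t)) * (‖h T₀‖ + ε / 2 * (Real.exp (μ * t) - Real.exp (μ * T₀))) := by
        gcongr
    _ = Real.exp (-(μ * t)) * ‖h T₀‖ + ε / 2 * (Real.exp (-(μ * t)) * Real.exp (μ * t))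
        - ε / 2 * (Real.exp (-(μ * t)) * Real.exp (μ * T₀)) := by ring
    _ < ε := by
        rw [h3]
        have : 0 ≤ ε / 2 * (Real.exp (-(μ * t)) * Real.exp (μ * T₀)) := by positivity
        linarith

/-- Peeling off one factor: `(M - z) q` solves the same system with input `(M - z) g`, so it tends
to zero by induction. Then `q' = z q + ((M - z) q + g)` is a scalar equation with vanishing input.
No matrix exponential or Jordan form is involved. -/
theorem tendsto_zero_of_tendsto_prod_sub (M : E →L[ℂ] E) (l : List ℂ) (hl : ∀ z ∈ l, z.re < 0) :
    ∀ q g : ℝ → E, ContinuousOn q (Ici 0) →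
      (∀ t, 0 ≤ t → HasDerivWithinAt q (M (q t) + g t) (Ici t) t) → Tendsto g atTop (𝓝 0) →
      Tendsto (fun t => (l.map fun z => M - z • 1).prod (q t)) atTop (𝓝 0) →
      Tendsto q atTop (𝓝 0) := by
  induction l with
  | nil => intro q g _ _ _ h; simpa using h
  | cons z l ih =>
    intro q g hc hq hg h
    have hcomm : (l.map fun z => M - z • 1).prod * (M - z • 1) =
        ((z :: l).map fun z => M - z • 1).prod := by
      rw [List.map_cons, List.prod_cons]
      refine (Commute.list_prod_right _ _ fun y hy => ?_).eq.symm
      obtain ⟨y, -, rfl⟩ := List.mem_map.1 hy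
      exact (((Commute.refl M).sub_left ((Commute.one_left M).smul_left z))).sub_right
        ((Commute.one_right _).smul_right y)
    have h1 : Tendsto (fun t => (M - z • 1) (q t)) atTop (𝓝 0) := by
      refine ih (fun y hy => hl y (List.mem_cons_of_mem _ hy)) _ (fun t => (M - z • 1) (g t))
        ((M - z • 1).continuous.comp_continuousOn hc) (fun t ht => ?_) ?_ ?_
      · have := ((M - z • 1).restrictScalars ℝ).hasFDerivAt.comp_hasDerivWithinAt t (hq t ht)
        refine this.congr_deriv ?_
        simp [smul_add]
        abel
      · rw [← map_zero (M - z • 1)]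
        exact ((M - z • 1).continuous.tendsto 0).comp hg
      · rw [← hcomm] at h
        exact h
    refine tendsto_zero_of_hasDerivWithinAt_smul_add (hl z List.mem_cons_self) hc
      (g := fun t => (M - z • 1) (q t) + g t) (fun t ht => (hq t ht).congr_deriv ?_) ?_
    · simp only [_root_.sub_apply, _root_.smul_apply, one_apply_eq_self]
      abel
    · simpa using h1.add hg

end Complex

theorem tendsto_zero_of_hasDerivWithinAt_mulVec_complex {m : ℕ} {M : Matrix (Fin m) (Fin m) ℂ}
    (hM : ∀ z ∈ spectrum ℂ M, z.re < 0) {q g : ℝ → Fin m → ℂ} (hc : ContinuousOn q (Ici 0))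
    (hq : ∀ t, 0 ≤ t → HasDerivWithinAt q (M *ᵥ q t + g t) (Ici t) t)
    (hg : Tendsto g atTop (𝓝 0)) : Tendsto q atTop (𝓝 0) := by
  let φ : Matrix (Fin m) (Fin m) ℂ →ₐ[ℂ] ((Fin m → ℂ) →L[ℂ] (Fin m → ℂ)) :=
    ((Matrix.toLinAlgEquiv' (R := ℂ) (n := Fin m)).trans
      (Module.End.toContinuousLinearMap (Fin m → ℂ)) :
        Matrix (Fin m) (Fin m) ℂ ≃ₐ[ℂ] ((Fin m → ℂ) →L[ℂ] (Fin m → ℂ))).toAlgHom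
  -- Cayley–Hamilton, with the characteristic polynomial split over `ℂ`.
  have hprod : (M.charpoly.roots.toList.map fun z => φ M - z • 1).prod = 0 := by
    have h1 := (IsAlgClosed.splits M.charpoly).eq_prod_roots_of_monic M.charpoly_monic
    have h2 : aeval (φ M) M.charpoly = 0 := by
      rw [aeval_algHom_apply, Matrix.aeval_self_charpoly, map_zero]
    rw [h1, ← Multiset.coe_toList M.charpoly.roots, Multiset.map_coe, Multiset.prod_coe,
      map_list_prod, List.map_map] at h2
    rw [← h2]
    congr 1
    refine List.map_congr_left fun z _ => ?_
    simp [Algebra.algebraMap_eq_smul_one]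
  refine tendsto_zero_of_tendsto_prod_sub (φ M) M.charpoly.roots.toList (fun z hz => hM z ?_) q g hc
    hq hg ?_
  · rw [Matrix.mem_spectrum_iff_isRoot_charpoly]
    exact isRoot_of_mem_roots (Multiset.mem_toList.1 hz)
  · simp [hprod]

theorem HurwitzMatrix.tendsto_zero {m : ℕ} {M : Matrix (Fin m) (Fin m) ℝ} (hM : HurwitzMatrix M)
    {q g : ℝ → Fin m → ℝ} (hc : ContinuousOn q (Ici 0))
    (hq : ∀ t, 0 ≤ t → HasDerivWithinAt q (M *ᵥ q t + g t) (Ici t) t)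
    (hg : Tendsto g atTop (𝓝 0)) : Tendsto q atTop (𝓝 0) := by
  have hcoe : ∀ i, (∀ t, 0 ≤ t → HasDerivWithinAt (fun t => (q t i : ℂ))
      (((M *ᵥ q t + g t) i : ℝ) : ℂ) (Ici t) t) := fun i t ht =>
    (hasDerivWithinAt_pi.1 (hq t ht) i).ofReal_comp
  have := tendsto_zero_of_hasDerivWithinAt_mulVec_complex hM (q := fun t i => (q t i : ℂ))
    (g := fun t i => (g t i : ℂ))
    (continuousOn_pi.2 fun i => Complex.continuous_ofReal.comp_continuousOn
      (continuousOn_pi.1 hc i))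
    (fun t ht => hasDerivWithinAt_pi.2 fun i => (hcoe i t ht).congr_deriv (by
      simp [Matrix.mulVec, dotProduct]))
    (tendsto_pi_nhds.2 fun i => by
      simpa [Function.comp_def] using
        (Complex.continuous_ofReal.tendsto 0).comp (tendsto_pi_nhds.1 hg i))
  refine tendsto_pi_nhds.2 fun i => ?_
  simpa [Function.comp_def] using (Complex.continuous_re.tendsto 0).comp (tendsto_pi_nhds.1 this i)

theorem HurwitzMatrix.isUnit_det {m : ℕ} {M : Matrix (Fin m) (Fin m) ℝ} (hM : HurwitzMatrix M) :
    IsUnit M.det := by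
  have h0 : (0 : ℂ) ∉ spectrum ℂ (M.map ((↑) : ℝ → ℂ)) := fun h => by simpa using hM 0 h
  rw [spectrum.zero_notMem_iff, Matrix.isUnit_iff_isUnit_det, isUnit_iff_ne_zero] at h0
  rw [isUnit_iff_ne_zero]
  intro hdet
  apply h0
  have := (Complex.ofRealHom.map_det M).symm
  rw [hdet, map_zero] at this
  exact this

/-- Translating by the equilibrium `-(M⁻¹ *ᵥ g₀)` leaves the vanishing input `g - g₀`. -/
theorem HurwitzMatrix.tendsto_of_tendsto {m : ℕ} {M : Matrix (Fin m) (Fin m) ℝ}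
    (hM : HurwitzMatrix M) {q g : ℝ → Fin m → ℝ} {g₀ : Fin m → ℝ} (hc : ContinuousOn q (Ici 0))
    (hq : ∀ t, 0 ≤ t → HasDerivWithinAt q (M *ᵥ q t + g t) (Ici t) t)
    (hg : Tendsto g atTop (𝓝 g₀)) : Tendsto q atTop (𝓝 (-(M⁻¹ *ᵥ g₀))) := by
  have hMg : M *ᵥ (M⁻¹ *ᵥ g₀) = g₀ := by
    rw [Matrix.mulVec_mulVec, Matrix.mul_nonsing_inv _ hM.isUnit_det, Matrix.one_mulVec]
  have := hM.tendsto_zero (q := fun t => q t + M⁻¹ *ᵥ g₀) (g := fun t => g t - g₀)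
    (hc.add continuousOn_const)
    (fun t ht => ((hq t ht).add_const _).congr_deriv (by rw [Matrix.mulVec_add, hMg]; abel))
    (by simpa using hg.sub_const g₀)
  simpa using this.sub_const (M⁻¹ *ᵥ g₀)

theorem HurwitzMatrix.exists_add_smul_one {m : ℕ} {M : Matrix (Fin m) (Fin m) ℝ}
    (hM : HurwitzMatrix M) : ∃ ε : ℝ, 0 < ε ∧ HurwitzMatrix (M + ε • 1) := by
  have hfin : (spectrum ℂ (M.map ((↑) : ℝ → ℂ))).Finite := Matrix.finite_spectrum _
  obtain ⟨ε, hε, h⟩ : ∃ ε : ℝ, 0 < ε ∧ ∀ z ∈ spectrum ℂ (M.map ((↑) : ℝ → ℂ)), z.re < -ε := by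
    have : ∀ᶠ ε : ℝ in 𝓝[>] 0, ∀ z ∈ spectrum ℂ (M.map ((↑) : ℝ → ℂ)), z.re < -ε := by
      rw [eventually_all_finite hfin]
      intro z hz
      have := hM z hz
      filter_upwards [Ioo_mem_nhdsGT (by linarith : (0 : ℝ) < -z.re)] with ε hε
      linarith [hε.2]
    obtain ⟨ε, h1, h2⟩ := (this.and self_mem_nhdsWithin).exists
    exact ⟨ε, h2, h1⟩
  refine ⟨ε, hε, fun z hz => ?_⟩
  have hmap : (M + ε • (1 : Matrix (Fin m) (Fin m) ℝ)).map ((↑) : ℝ → ℂ) =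
      algebraMap ℂ _ (ε : ℂ) + M.map ((↑) : ℝ → ℂ) := by
    ext i j
    rcases eq_or_ne i j with rfl | hij
    · simp [Matrix.algebraMap_matrix_apply, add_comm]
    · simp [Matrix.algebraMap_matrix_apply, hij]
  rw [hmap, ← sub_add_cancel z (ε : ℂ), spectrum.add_mem_add_iff] at hz
  have := h _ hz
  rw [Complex.sub_re, Complex.ofReal_re] at this
  linarith

/-- The spectrum is finite, so `M + ε • 1` is still Hurwitz for some `ε > 0`. It governs `exp (ε t)
• q t`, which thus tends to zero and is bounded. -/
theorem HurwitzMatrix.exists_norm_le_exp {m : ℕ} {M : Matrix (Fin m) (Fin m) ℝ}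
    (hM : HurwitzMatrix M) : ∃ ε : ℝ, 0 < ε ∧ ∀ q : ℝ → Fin m → ℝ, ContinuousOn q (Ici 0) →
      (∀ t, 0 ≤ t → HasDerivWithinAt q (M *ᵥ q t) (Ici t) t) →
      ∃ D, ∀ t, 0 ≤ t → ‖q t‖ ≤ D * Real.exp (-(ε * t)) := by
  obtain ⟨ε, hε, hMε⟩ := hM.exists_add_smul_one
  refine ⟨ε, hε, fun q hc hq => ?_⟩
  have hexp : ∀ t, HasDerivAt (fun t => Real.exp (ε * t)) (Real.exp (ε * t) * ε) t := fun t => by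
    simpa using ((hasDerivAt_id t).const_mul ε).exp
  let f : ℝ → Fin m → ℝ := fun t => Real.exp (ε * t) • q t
  have hfc : ContinuousOn f (Ici 0) := ContinuousOn.smul
    (fun t _ => (hexp t).continuousAt.continuousWithinAt) hc
  have hf : Tendsto f atTop (𝓝 0) := by
    refine hMε.tendsto_zero (g := 0) hfc (fun t ht => ?_) tendsto_const_nhds
    refine ((hexp t).hasDerivWithinAt.smul (hq t ht)).congr_deriv ?_
    simp only [f, Matrix.add_mulVec, Matrix.smul_mulVec, Matrix.mulVec_smul, Matrix.one_mulVec,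
      Pi.zero_apply, add_zero]
    module
  obtain ⟨T, hT⟩ := eventually_atTop.1 (hf.eventually_mem (Metric.closedBall_mem_nhds 0 one_pos))
  obtain ⟨D, hD⟩ := (isCompact_Icc (a := (0 : ℝ)) (b := T)).exists_bound_of_continuousOn
    (hfc.mono Icc_subset_Ici_self)
  refine ⟨max D 1, fun t ht => ?_⟩
  have h1 : ‖f t‖ ≤ max D 1 := by
    rcases le_total t T with h | h
    · exact (hD t ⟨ht, h⟩).trans (le_max_left _ _)
    · exact (mem_closedBall_zero_iff.1 (hT t h)).trans (le_max_right _ _)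
  have h2 : ‖f t‖ = Real.exp (ε * t) * ‖q t‖ := by
    rw [norm_smul, Real.norm_eq_abs, abs_of_pos (Real.exp_pos _)]
  rw [Real.exp_neg, ← div_eq_mul_inv, le_div_iff₀ (Real.exp_pos _), mul_comm, ← h2]
  exact h1

/-! ### The companion matrix of the gain polynomial -/

/-- The companion matrix of `Xⁿ + aₙ Xⁿ⁻¹ + ⋯ + a₁`. -/
def companion {R : Type*} [CommRing R] {n : ℕ} (a : Fin n → R) : Matrix (Fin n) (Fin n) R :=
  Matrix.of fun k l => Fin.snoc (α := fun _ => R) (Pi.single l 1) (-a l) k.succ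

/-- The product extends `v` by `-(a ⬝ᵥ v)` and shifts; the `snoc` form treats all rows alike and
includes `n = 0`. -/
theorem companion_mulVec {R : Type*} [CommRing R] {n : ℕ} (a v : Fin n → R) (k : Fin n) :
    (companion a *ᵥ v) k = Fin.snoc (α := fun _ => R) v (-(a ⬝ᵥ v)) k.succ := by
  simp only [companion, Matrix.mulVec, dotProduct, Matrix.of_apply]
  rcases Fin.eq_castSucc_or_eq_last k.succ with ⟨j, hj⟩ | hj
  · simp [hj, Pi.single_apply]
  · simp [hj]

/-- An eigenvector for `z`, extended by `-(a ⬝ᵥ v)`, is a geometric sequence of ratio `z` with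
nonzero first term; its last entry says that `z` is a root of the polynomial. -/
theorem HurwitzPoly.hurwitzMatrix_companion {n : ℕ} {a : Fin n → ℝ}
    (ha : HurwitzPoly (gainPoly a)) : HurwitzMatrix (companion a) := by
  intro z hz
  apply ha
  have hmap : (companion a).map ((↑) : ℝ → ℂ) = companion fun k => (a k : ℂ) := by
    ext k l
    simp only [companion, Matrix.map_apply, Matrix.of_apply]
    rcases Fin.eq_castSucc_or_eq_last k.succ with ⟨j, hj⟩ | hj
    · simp [hj, Pi.single_apply, apply_ite ((↑) : ℝ → ℂ)]
    · simp [hj]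
  rw [hmap, ← Matrix.spectrum_toLin', ← Module.End.hasEigenvalue_iff_mem_spectrum] at hz
  obtain ⟨v, hv⟩ := hz.exists_hasEigenvector
  have hv1 : (companion fun k => (a k : ℂ)) *ᵥ v = z • v := by simpa using hv.apply_eq_smul
  set y : Fin (n + 1) → ℂ := Fin.snoc (α := fun _ => ℂ) v (-((fun k => (a k : ℂ)) ⬝ᵥ v)) with hy
  have hyc : ∀ k : Fin n, y k.castSucc = v k := fun k => by simp [hy]
  have hstep : ∀ k : Fin n, y k.succ = z * y k.castSucc := fun k => by
    have := congrFun hv1 k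
    rw [companion_mulVec] at this
    rw [hyc]
    exact this
  have hpow : ∀ k : Fin (n + 1), y k = z ^ (k : ℕ) * y 0 := by
    intro k
    induction k using Fin.induction with
    | zero => simp
    | succ k ih => rw [hstep, ih, Fin.val_succ, Fin.val_castSucc, pow_succ']; ring
  have hy0 : y 0 ≠ 0 := by
    intro h
    apply hv.2
    ext k
    rw [← hyc, hpow, h]
    simp
  have hlast : y (Fin.last n) = -∑ k, (a k : ℂ) * v k := by simp [hy, dotProduct]
  rw [hpow] at hlast
  have hsum : ∑ k, (a k : ℂ) * v k = (∑ k : Fin n, (a k : ℂ) * z ^ (k : ℕ)) * y 0 := by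
    rw [Finset.sum_mul]
    refine Finset.sum_congr rfl fun k _ => ?_
    rw [← hyc, hpow, Fin.val_castSucc, mul_assoc]
  rw [hsum, Fin.val_last] at hlast
  have : aeval z (gainPoly a) = z ^ n + ∑ k : Fin n, (a k : ℂ) * z ^ (k : ℕ) := by
    simp [gainPoly]
  rw [this]
  refine (mul_eq_zero.1 ?_).resolve_right hy0
  rw [add_mul, hlast]
  ring

/-! ### The chain of integrators -/

theorem sysA_mulVec_castSucc {n : ℕ} (v : Fin (n + 1) → ℝ) (k : Fin n) :
    (sysA n *ᵥ v) k.castSucc = v k.succ := by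
  simp only [sysA, Matrix.mulVec, dotProduct, Matrix.of_apply, ite_mul, one_mul, zero_mul]
  rw [Finset.sum_eq_single k.succ]
  · simp
  · intro j _ hj
    rw [if_neg]
    exact fun h => hj (Fin.ext (by simpa using h))
  · simp

theorem sysA_mulVec_last {n : ℕ} (v : Fin (n + 1) → ℝ) : (sysA n *ᵥ v) (Fin.last n) = 0 := by
  simp only [sysA, Matrix.mulVec, dotProduct, Matrix.of_apply]
  refine Finset.sum_eq_zero fun j _ => ?_
  rw [if_neg, zero_mul]
  have := j.isLt
  simp only [Fin.val_last]
  omega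

theorem gainK₂_dotProduct {n : ℕ} (a : Fin n → ℝ) (v : Fin (n + 1) → ℝ) :
    gainK₂ a ⬝ᵥ v = a ⬝ᵥ (fun k => v k.castSucc) + v (Fin.last n) := by
  simp [gainK₂, dotProduct, Fin.sum_univ_castSucc]

theorem gainK₂_dotProduct_sysA_mulVec {n : ℕ} (a : Fin n → ℝ) (v : Fin (n + 1) → ℝ) :
    gainK₂ a ⬝ᵥ (sysA n *ᵥ v) = -(gainK₁ a ⬝ᵥ v) := by
  rw [gainK₂_dotProduct, sysA_mulVec_last]
  simp [sysA_mulVec_castSucc, gainK₁, dotProduct, Fin.sum_univ_succ]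

theorem gainK₂_dotProduct_sysB {n : ℕ} (a : Fin n → ℝ) : gainK₂ a ⬝ᵥ sysB n = 1 := by
  simp [gainK₂, sysB]

theorem observerMatrix_mulVec {n : ℕ} (C K₃ v : Fin (n + 1) → ℝ) :
    observerMatrix C K₃ *ᵥ v = sysA n *ᵥ v + (C ⬝ᵥ v) • K₃ := by
  rw [observerMatrix, Matrix.add_mulVec, Matrix.vecMulVec_mulVec, op_smul_eq_smul]

/-! ### The communication weights -/

open Classical in
/-- The weight of the edge from `j` to `i`, zero if there is none. -/
def linkWeight {N : ℕ} (G : Digraph (Fin N)) (α : Fin N → Fin N → ℝ) (i j : Fin N) : ℝ :=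
  if G.Adj j i then α i j else 0

theorem control_eq {n N : ℕ} (a : Fin n → ℝ) (G : Digraph (Fin N)) (α : Fin N → Fin N → ℝ)
    (s : Fin N → Fin (n + 1) → ℝ) (i : Fin N) :
    control a G α s i = gainK₁ a ⬝ᵥ s i +
      ∑ j, linkWeight G α i j * (gainK₂ a ⬝ᵥ s j - gainK₂ a ⬝ᵥ s i) := by
  simp only [control, neighbors, linkWeight, Finset.sum_filter, dotProduct_sub]
  rw [sub_eq_add_neg, ← Finset.sum_neg_distrib]
  congr 1
  refine Finset.sum_congr rfl fun j _ => ?_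
  split_ifs <;> ring

section Weights

variable {N : ℕ} {S : Type*} {G : S → Digraph (Fin N)} {α : S → Fin N → Fin N → ℝ}

theorem linkWeight_nonneg (hα : ∀ p i j, (G p).Adj j i → 0 < α p i j) (p : S) (i j : Fin N) :
    0 ≤ linkWeight (G p) (α p) i j := by
  unfold linkWeight
  split_ifs with h
  exacts [(hα p i j h).le, le_rfl]

theorem exists_sum_linkWeight_le [Finite S] (G : S → Digraph (Fin N))
    (α : S → Fin N → Fin N → ℝ) :
    ∃ Λ, 0 ≤ Λ ∧ ∀ p i, ∑ j, linkWeight (G p) (α p) i j ≤ Λ := by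
  obtain ⟨B, hB⟩ := (Set.finite_range fun q : S × Fin N =>
    ∑ j, linkWeight (G q.1) (α q.1) q.2 j).bddAbove
  exact ⟨max B 0, le_max_right _ _, fun p i => (hB ⟨(p, i), rfl⟩).trans (le_max_left _ _)⟩

theorem exists_le_linkWeight [Finite S] (hα : ∀ p i j, (G p).Adj j i → 0 < α p i j) :
    ∃ κ, 0 < κ ∧ ∀ p i j, (G p).Adj j i → κ ≤ linkWeight (G p) (α p) i j := by
  have : ∀ᶠ κ : ℝ in 𝓝[>] 0, ∀ p i j, (G p).Adj j i → κ ≤ linkWeight (G p) (α p) i j := by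
    simp only [eventually_all]
    intro p i j h
    rw [linkWeight, if_pos h]
    filter_upwards [Ioc_mem_nhdsGT (hα p i j h)] with κ hκ using hκ.2
  obtain ⟨κ, h1, h2⟩ := (this.and self_mem_nhdsWithin).exists
  exact ⟨κ, h2, h1⟩

theorem IsSwitchingSignal.exists_dwell {σ : ℝ → S} (hσ : IsSwitchingSignal σ) :
    ∃ d, 0 < d ∧ ∀ τ, d ≤ τ → ∃ r, τ - d ≤ r ∧ r ≤ τ ∧ ∀ u ∈ Ico r (r + d), σ u = σ τ := by
  obtain ⟨d, hd, t, ht0, hdt, hconst⟩ := hσ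
  refine ⟨d, hd, fun τ hτ => ?_⟩
  have hgrow : ∀ k : ℕ, k * d ≤ t k := by
    intro k
    induction k with
    | zero => simp [ht0]
    | succ k ih => push_cast; linarith [hdt k]
  have hex : ∃ k, τ < t (k + 1) := by
    obtain ⟨k, hk⟩ := exists_nat_gt (τ / d)
    rw [div_lt_iff₀ hd] at hk
    exact ⟨k, by linarith [hgrow k, hdt k]⟩
  classical
  set k := Nat.find hex
  have hk : τ < t (k + 1) := Nat.find_spec hex
  have hk' : t k ≤ τ := by
    rcases Nat.eq_zero_or_pos k with h0 | hpos
    · rw [h0, ht0]; linarith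
    · have := Nat.find_min hex (Nat.pred_lt hpos.ne')
      rw [← Nat.succ_eq_add_one, Nat.succ_pred hpos.ne'] at this
      exact not_lt.1 this
  have hστ := hconst k τ ⟨hk', hk⟩
  -- Starting at the later of the switching time and `τ - d` keeps the interval of length `d` both
  -- inside the dwell interval and close to `τ`.
  refine ⟨max (t k) (τ - d), le_max_right _ _, max_le hk' (by linarith), fun u hu => ?_⟩
  rw [hστ]
  refine hconst k u ⟨(le_max_left _ _).trans hu.1, hu.2.trans_le ?_⟩
  rw [← le_sub_iff_add_le]
  exact max_le (by linarith [hdt k]) (by linarith)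

theorem exists_edge_leaving {V : Type*} {R : V → V → Prop} {c v : V}
    (h : Relation.ReflTransGen R c v) {H : Set V} (hc : c ∈ H) (hv : v ∉ H) :
    ∃ j ∈ H, ∃ i ∉ H, R j i := by
  induction h with
  | refl => exact absurd hc hv
  | @tail b e _ hbe ih =>
    by_cases hb : b ∈ H
    · exact ⟨b, hb, e, hv, hbe⟩
    · exact ih hb

theorem UniformlyJointlyQSC.exists_hasPersistentCenters {σ : ℝ → S} (hσ : IsSwitchingSignal σ)
    (hconn : UniformlyJointlyQSC G σ) {κ : ℝ}
    (hκ : ∀ p i j, (G p).Adj j i → κ ≤ linkWeight (G p) (α p) i j) :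
    ∃ d L, 0 < d ∧ 0 < L ∧
      HasPersistentCenters (fun t i j => linkWeight (G (σ t)) (α (σ t)) i j) κ d L := by
  obtain ⟨T, hT, hconn⟩ := hconn
  obtain ⟨d, hd, hdwell⟩ := hσ.exists_dwell
  -- A margin `d` on each side of the connectivity window makes room for the dwell interval around
  -- an active time `τ`; it also makes the starting time `t + d` positive.
  refine ⟨d, T + 2 * d, hd, by positivity, fun t ht => ?_⟩
  obtain ⟨c, hc⟩ := hconn (t + d) (by positivity)
  refine ⟨c, fun H hcH hH => ?_⟩
  obtain ⟨v, hv⟩ := (Set.ne_univ_iff_exists_notMem H).1 hH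
  obtain ⟨j, hj, i, hi, τ, hτ, hadj⟩ := exists_edge_leaving (hc v fun h => hv (h ▸ hcH)) hcH hv
  obtain ⟨r, hr1, hr2, hr⟩ := hdwell τ (by linarith [hτ.1])
  refine ⟨j, hj, i, hi, r, by linarith [hτ.1], by linarith [hτ.2], fun u hu => ?_⟩
  simp only [hr u hu]
  exact hκ _ _ _ hadj

end Weights

/-! ### Trajectories of the closed loop -/

namespace IsTrajectory

variable {n N : ℕ} {S : Type*} {a : Fin n → ℝ} {C K₃ : Fin (n + 1) → ℝ}
  {G : S → Digraph (Fin N)} {α : S → Fin N → Fin N → ℝ} {σ : ℝ → S}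
  {x s : Fin N → ℝ → Fin (n + 1) → ℝ}

/-- Agent and observer receive the same input, which cancels. -/
theorem hasDerivWithinAt_error (h : IsTrajectory a C K₃ G α σ x s) (i : Fin N) {t : ℝ}
    (ht : 0 ≤ t) : HasDerivWithinAt (fun t => s i t - x i t)
      (observerMatrix C K₃ *ᵥ (s i t - x i t)) (Ici t) t := by
  refine ((h.observer_eq i t ht).sub (h.state_eq i t ht)).congr_deriv ?_
  simp only [observerMatrix_mulVec, Matrix.mulVec_sub]
  module

theorem hasDerivWithinAt_observer (h : IsTrajectory a C K₃ G α σ x s) (i : Fin N) {t : ℝ}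
    (ht : 0 ≤ t) : HasDerivWithinAt (s i)
      (sysA n *ᵥ s i t + control a (G (σ t)) (α (σ t)) (fun j => s j t) i • sysB n
        + (C ⬝ᵥ (s i t - x i t)) • K₃) (Ici t) t := by
  refine (h.observer_eq i t ht).congr_deriv ?_
  simp only [observerMatrix_mulVec, dotProduct_sub]
  module

theorem hasDerivWithinAt_gainK₂ (h : IsTrajectory a C K₃ G α σ x s) (i : Fin N) {t : ℝ}
    (ht : 0 ≤ t) : HasDerivWithinAt (fun t => gainK₂ a ⬝ᵥ s i t)
      (∑ j, linkWeight (G (σ t)) (α (σ t)) i j * (gainK₂ a ⬝ᵥ s j t - gainK₂ a ⬝ᵥ s i t)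
        + (C ⬝ᵥ (s i t - x i t)) * (gainK₂ a ⬝ᵥ K₃)) (Ici t) t := by
  have h1 : HasDerivWithinAt (fun t => gainK₂ a ⬝ᵥ s i t) _ (Ici t) t :=
    HasDerivWithinAt.fun_sum fun k _ =>
      ((hasDerivWithinAt_pi.1 (h.hasDerivWithinAt_observer i ht)) k).const_mul (gainK₂ a k)
  refine h1.congr_deriv ?_
  change gainK₂ a ⬝ᵥ _ = _
  rw [dotProduct_add, dotProduct_add, dotProduct_smul, dotProduct_smul,
    gainK₂_dotProduct_sysA_mulVec, gainK₂_dotProduct_sysB, control_eq]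
  simp only [smul_eq_mul]
  ring

/-- Eliminating the last entry by `s_last = K₂ s - a ⬝ᵥ init` closes the system; `K₂ s` enters only
the last row. -/
theorem hasDerivWithinAt_init (h : IsTrajectory a C K₃ G α σ x s) (i : Fin N) {t : ℝ}
    (ht : 0 ≤ t) : HasDerivWithinAt (fun t (k : Fin n) => s i t k.castSucc)
      (companion a *ᵥ (fun k => s i t k.castSucc) + fun k =>
        Fin.snoc (α := fun _ => ℝ) (0 : Fin n → ℝ) (gainK₂ a ⬝ᵥ s i t) k.succ
          + (C ⬝ᵥ (s i t - x i t)) * K₃ k.castSucc) (Ici t) t := by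
  refine hasDerivWithinAt_pi.2 fun k =>
    ((hasDerivWithinAt_pi.1 (h.hasDerivWithinAt_observer i ht)) k.castSucc).congr_deriv ?_
  simp only [Pi.add_apply, Pi.smul_apply, smul_eq_mul, companion_mulVec, sysA_mulVec_castSucc,
    gainK₂_dotProduct]
  have hB : sysB n k.castSucc = 0 := by simp [sysB, Fin.castSucc_ne_last]
  rw [hB, mul_zero, add_zero, ← add_assoc]
  congr 1
  rcases Fin.eq_castSucc_or_eq_last k.succ with ⟨j, hj⟩ | hj
  · simp [hj]
  · simp [hj]

end IsTrajectory

end HighOrderConsensus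

end

theorem theorem2 {n N : ℕ} {S : Type*} [Finite S]
    (a : Fin n → ℝ) (C K₃ : Fin (n + 1) → ℝ)
    (G : S → Digraph (Fin N)) (hG : ∀ p i, ¬ (G p).Adj i i)
    (α : S → Fin N → Fin N → ℝ) (hα : ∀ p i j, (G p).Adj j i → 0 < α p i j)
    (σ : ℝ → S) (hσ : HighOrderConsensus.IsSwitchingSignal σ)
    (hobs : HighOrderConsensus.HurwitzMatrix (HighOrderConsensus.observerMatrix C K₃))
    (hpoly : HighOrderConsensus.HurwitzPoly (HighOrderConsensus.gainPoly a))
    (hconn : HighOrderConsensus.UniformlyJointlyQSC G σ)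
    (x s : Fin N → ℝ → Fin (n + 1) → ℝ)
    (htraj : HighOrderConsensus.IsTrajectory a C K₃ G α σ x s) :
    HighOrderConsensus.ReachesConsensus x := by
  open HighOrderConsensus in
  have hne : Nonempty (Fin N) := by
    obtain ⟨T, -, h⟩ := hconn
    obtain ⟨c, -⟩ := h 1 one_pos
    exact ⟨c⟩
  obtain ⟨Λ, hΛ0, hΛ⟩ := exists_sum_linkWeight_le G α
  obtain ⟨κ, hκ0, hκ⟩ := exists_le_linkWeight hα
  obtain ⟨d, L, hd, hL, hcenters⟩ := hconn.exists_hasPersistentCenters hσ hκ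
  obtain ⟨ε, hε, hexp⟩ := hobs.exists_norm_le_exp
  have herr := fun i => hexp (fun t => s i t - x i t)
    ((htraj.continuousOn_observer i).sub (htraj.continuousOn_state i))
    (fun t ht => htraj.hasDerivWithinAt_error i ht)
  choose D hD using herr
  have herr0 : ∀ i, Tendsto (fun t => s i t - x i t) atTop (𝓝 0) := by
    intro i
    have h1 : Tendsto (fun t : ℝ => D i * Real.exp (-(ε * t))) atTop (𝓝 0) := by
      simpa [Function.comp_def] using (Real.tendsto_exp_neg_atTop_nhds_zero.comp
        (tendsto_id.const_mul_atTop hε)).const_mul (D i)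
    exact squeeze_zero_norm' ((eventually_ge_atTop 0).mono fun t ht => hD i t ht) h1
  have hξc : ∀ i, ContinuousOn (fun t => gainK₂ a ⬝ᵥ s i t) (Ici 0) := fun i =>
    continuousOn_finsetSum _ fun k _ =>
      continuousOn_const.mul (continuousOn_pi.1 (htraj.continuousOn_observer i) k)
  have hCe : ∀ v : Fin (n + 1) → ℝ, |C ⬝ᵥ v| ≤ (∑ k, |C k|) * ‖v‖ := fun v => by
    rw [Finset.sum_mul]
    refine (Finset.abs_sum_le_sum_abs _ _).trans (Finset.sum_le_sum fun k _ => ?_)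
    rw [abs_mul]
    exact mul_le_mul_of_nonneg_left (norm_le_pi_norm v k) (abs_nonneg _)
  obtain ⟨Dmax, hDmax⟩ := (Set.finite_range D).bddAbove
  obtain ⟨ξstar, hξ⟩ := exists_forall_tendsto_of_perturbed_consensus
    (w := fun t i j => linkWeight (G (σ t)) (α (σ t)) i j)
    (ξ := fun i t => gainK₂ a ⬝ᵥ s i t)
    (δ := fun i t => (C ⬝ᵥ (s i t - x i t)) * (gainK₂ a ⬝ᵥ K₃))
    (D := (∑ k, |C k|) * Dmax * |gainK₂ a ⬝ᵥ K₃|)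
    (fun t => linkWeight_nonneg hα (σ t)) (fun t => hΛ (σ t)) hΛ0 hκ0 hd hL hcenters hε hξc
    (fun i t ht => htraj.hasDerivWithinAt_gainK₂ i ht)
    (fun i t ht => by
      rw [abs_mul]
      calc _ ≤ (∑ k, |C k|) * (Dmax * Real.exp (-(ε * t))) * |gainK₂ a ⬝ᵥ K₃| := by
            gcongr
            refine (hCe _).trans (mul_le_mul_of_nonneg_left ((hD i t ht).trans ?_)
              (Finset.sum_nonneg fun _ _ => abs_nonneg _))
            gcongr
            exact hDmax ⟨i, rfl⟩
        _ = _ := by ring)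
  -- The limiting input, `ξstar` in the last coordinate; `qstar` is the corresponding equilibrium,
  -- the same for every agent.
  set g₀ : Fin n → ℝ := fun k => Fin.snoc (α := fun _ => ℝ) (0 : Fin n → ℝ) ξstar k.succ
  set qstar : Fin n → ℝ := -((companion a)⁻¹ *ᵥ g₀)
  have hCe0 : ∀ i, Tendsto (fun t => C ⬝ᵥ (s i t - x i t)) atTop (𝓝 0) := fun i => by
    have : Continuous fun v : Fin (n + 1) → ℝ => C ⬝ᵥ v := by fun_prop
    simpa [Function.comp_def] using (this.tendsto 0).comp (herr0 i)
  have hq : ∀ i, Tendsto (fun t (k : Fin n) => s i t k.castSucc) atTop (𝓝 qstar) := by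
    intro i
    refine hpoly.hurwitzMatrix_companion.tendsto_of_tendsto
      (continuousOn_pi.2 fun k => continuousOn_pi.1 (htraj.continuousOn_observer i) k.castSucc)
      (fun t ht => htraj.hasDerivWithinAt_init i ht) (tendsto_pi_nhds.2 fun k => ?_)
    have h1 : Tendsto (fun t => Fin.snoc (α := fun _ => ℝ) (0 : Fin n → ℝ)
        (gainK₂ a ⬝ᵥ s i t) k.succ) atTop (𝓝 (g₀ k)) := by
      rcases Fin.eq_castSucc_or_eq_last k.succ with ⟨j, hj⟩ | hj
      · simp [g₀, hj]
      · simpa [g₀, hj] using hξ i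
    simpa using h1.add ((hCe0 i).mul_const (K₃ k.castSucc))
  refine ⟨Fin.snoc (α := fun _ => ℝ) qstar (ξstar - a ⬝ᵥ qstar), fun i => ?_⟩
  have hs : Tendsto (s i) atTop
      (𝓝 (Fin.snoc (α := fun _ => ℝ) qstar (ξstar - a ⬝ᵥ qstar))) := by
    refine tendsto_pi_nhds.2 fun k => ?_
    rcases Fin.eq_castSucc_or_eq_last k with ⟨j, rfl⟩ | rfl
    · simpa using tendsto_pi_nhds.1 (hq i) j
    · have hc : Continuous fun v : Fin n → ℝ => a ⬝ᵥ v := by fun_prop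
      have := (hξ i).sub ((hc.tendsto qstar).comp (hq i))
      simpa [gainK₂_dotProduct, Function.comp_def] using this
  simpa using hs.sub (herr0 i)
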